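/- Let $G$ be a finite group, $p$ a prime dividing $|G|$, $G_p$ a Sylow $p$-subgroup of $G$, and $n\ge 0$ an integer. A $p$-subgroup $P\subseteq G$ is called $p$-centric if $Z(P)$ is a Sylow $p$-subgroup of $C_G(P)$; a $p$-centric subgroup $P$ is called principal $p$-radical if $N_G(P)/PC_G(P)$ has no non-trivial normal $p$-subgroup. Let $\mathcal{C}$ be the collection of all principal $p$-radical subgroups of $G$ (it contains every Sylow $p$-subgroup of $G$), and let $\mathcal{O}_{\mathcal{C}}$ be the category whose objects are the $G$-sets $G/P$ with $P\in\mathcal{C}$ and whose morphisms are the $G$-maps. For a group $H$ let $\mathrm{Char}_n(H)$ be the set of characters of $n$-dimensional complex representations of $H$. A $G$-map $f:G/P\to G/Q$ with $f(P)=gQ$ induces the map $\mathrm{Char}_n(Q)\to\mathrm{Char}_n(P)$ sending $\chi$ to $x\mapsto\chi(g^{-1}xg)$ (independent of the choice of $g$), so that $G/P\mapsto\mathrm{Char}_n(P)$ is a contravariant functor on $\mathcal{O}_{\mathcal{C}}$. Let $\mathrm{Char}_n^G(G_p)\subseteq\mathrm{Char}_n(G_p)$ be the subset of those characters that are restrictions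 to $G_p$ of class functions on $G$. Then the projection $$\varprojlim_{G/P\in\mathcal{O}_{\mathcal{C}}}\mathrm{Char}_n(P)\longrightarrow\mathrm{Char}_n(G_p)$$ is injective, and its image is exactly $\mathrm{Char}_n^G(G_p)$. -/

import Mathlib

open CategoryTheory

/-! ### Principal `p`-radical subgroups -/

/-- The subgroup `P C_G(P)` of `N_G(P)`, for a subgroup `P` of `G`. -/
def centralProduct {G : Type*} [Group G] (P : Subgroup G) :
    Subgroup (Subgroup.normalizer (P : Set G)) :=
  (P ⊔ Subgroup.centralizer (P : Set G)).subgroupOf (Subgroup.normalizer (P : Set G))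

instance centralProduct_normal {G : Type*} [Group G] (P : Subgroup G) :
    (centralProduct P).Normal := by
  rw [centralProduct, Subgroup.subgroupOf_sup Subgroup.le_normalizer
    (Subgroup.centralizer_le_normalizer (P : Set G)), ← Subgroup.normalizerMonoidHom_ker]
  infer_instance

/-- A group has no non-trivial normal `p`-subgroup. -/
def NoNormalPSubgroup (p : ℕ) (H : Type*) [Group H] : Prop :=
  ∀ K : Subgroup H, K.Normal → IsPGroup p K → K = ⊥

/-- A `p`-subgroup `P` of `G` is `p`-centric if `Z(P)` is a Sylow `p`-subgroup of `C_G(P)`. -/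
def IsPCentric {G : Type*} [Group G] (p : ℕ) (P : Subgroup G) : Prop :=
  IsPGroup p P ∧ ∃ S : Sylow p (Subgroup.centralizer (P : Set G)),
    (S : Subgroup (Subgroup.centralizer (P : Set G))).map
      (Subgroup.centralizer (P : Set G)).subtype = (Subgroup.center P).map P.subtype

/-- A `p`-centric subgroup `P` of `G` is principal `p`-radical if `N_G(P) / P C_G(P)` has no
non-trivial normal `p`-subgroup. -/
def IsPrincipalPRadical {G : Type*} [Group G] (p : ℕ) (P : Subgroup G) : Prop :=
  IsPCentric p P ∧ NoNormalPSubgroup p (Subgroup.normalizer (P : Set G) ⧸ centralProduct P)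

/-- The collection of all principal `p`-radical subgroups of `G`. -/
def principalPRadicals (p : ℕ) (G : Type*) [Group G] : Set (Subgroup G) :=
  {P | IsPrincipalPRadical p P}

theorem sylow_isPCentric {G : Type*} [Group G] {p : ℕ} (P : Sylow p G) :
    IsPCentric p (P : Subgroup G) := by
  refine ⟨P.isPGroup', ?_⟩
  have hle : (Subgroup.center (P : Subgroup G)).map (P : Subgroup G).subtype ≤
      Subgroup.centralizer ((P : Subgroup G) : Set G) := by
    rintro _ ⟨z, hz, rfl⟩
    rw [Subgroup.mem_centralizer_iff]
    intro h hh
    exact congrArg Subtype.val (Subgroup.mem_center_iff.mp hz ⟨h, hh⟩)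
  refine ⟨⟨((Subgroup.center (P : Subgroup G)).map (P : Subgroup G).subtype).subgroupOf _,
    ?_, ?_⟩, ?_⟩
  · refine IsPGroup.comap_of_injective ?_ _ (Subgroup.subtype_injective _)
    exact (P.isPGroup'.to_subgroup _).map _
  · intro Q hQ hle2
    refine le_antisymm ?_ hle2
    set Q' := Q.map (Subgroup.centralizer ((P : Subgroup G) : Set G)).subtype with hQ'
    have hQp : IsPGroup p Q' := hQ.map _
    have hQc : Q' ≤ Subgroup.centralizer ((P : Subgroup G) : Set G) := Subgroup.map_subtype_le _
    have hsup : IsPGroup p ((Q' ⊔ (P : Subgroup G) : Subgroup G)) :=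
      hQp.to_sup_of_normal_right' P.isPGroup'
        (hQc.trans (Subgroup.centralizer_le_normalizer _))
    have hQP : Q' ≤ (P : Subgroup G) := by
      have := P.is_maximal' hsup le_sup_right
      exact le_sup_left.trans this.le
    intro q hq
    have hq' : (q : G) ∈ Q' := ⟨q, hq, rfl⟩
    rw [Subgroup.mem_subgroupOf]
    refine ⟨⟨q, hQP hq'⟩, ?_, rfl⟩
    rw [SetLike.mem_coe, Subgroup.mem_center_iff]
    intro h
    exact Subtype.ext (Subgroup.mem_centralizer_iff.mp q.2 h h.2)
  · exact Subgroup.map_subgroupOf_eq_of_le hle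

/-- Every Sylow `p`-subgroup of a finite group is principal `p`-radical. -/
theorem sylow_mem_principalPRadicals {G : Type*} [Group G] [Finite G] {p : ℕ} [Fact p.Prime]
    (P : Sylow p G) : (P : Subgroup G) ∈ principalPRadicals p G := by
  refine ⟨sylow_isPCentric P, fun K _ hK => ?_⟩
  have h1 : ¬ p ∣ (centralProduct (P : Subgroup G)).index := by
    intro h
    refine (P.subtype Subgroup.le_normalizer).not_dvd_index (h.trans ?_)
    exact Subgroup.index_dvd_of_le (Subgroup.comap_mono le_sup_left)
  obtain ⟨k, hk⟩ := IsPGroup.iff_card.mp hK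
  rw [← Subgroup.card_eq_one]
  have h2 : Nat.card K ∣ (centralProduct (P : Subgroup G)).index := Subgroup.card_subgroup_dvd_card K
  rcases Nat.eq_zero_or_pos k with rfl | hpos
  · simpa using hk
  · exact absurd ((hk ▸ dvd_pow_self p hpos.ne').trans h2) h1

/-! ### Orbit categories -/

/-- The orbit category of a collection `C` of subgroups of `G`; its objects are the `G`-sets `G/P`
for `P ∈ C`, represented by `P`. -/
structure OrbitCat {G : Type*} [Group G] (C : Set (Subgroup G)) where
  /-- The subgroup `P`, standing for the `G`-set `G/P`. -/
  stab : Subgroup G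
  /-- The subgroup belongs to the collection. -/
  mem : stab ∈ C

/-- The morphisms of the orbit category are the `G`-maps `G/P → G/Q`. -/
instance orbitCatCategory {G : Type*} [Group G] (C : Set (Subgroup G)) :
    Category (OrbitCat C) where
  Hom X Y := (G ⧸ X.stab) →[G] (G ⧸ Y.stab)
  id _ := MulActionHom.id G
  comp f g := g.comp f
  id_comp f := MulActionHom.comp_id f
  comp_id f := MulActionHom.id_comp f
  assoc f g h := (MulActionHom.comp_assoc h g f).symm

/-! ### Characters -/

/-- `Char_n(H)`: the characters of the `n`-dimensional complex representations of `H`. -/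
def CharDeg (n : ℕ) (H : Type*) [Group H] : Set (H → ℂ) :=
  {χ | ∃ ρ : Representation ℂ H (Fin n → ℂ), χ = ρ.character}

/-- `Char_n^G(P)`: the degree `n` characters of `P` that are restrictions of class functions
on `G`. -/
def CharDegStable {G : Type*} [Group G] (n : ℕ) (P : Subgroup G) : Set (CharDeg n P) :=
  {χ | ∃ φ : G → ℂ, (∀ g x : G, φ (g * x * g⁻¹) = φ x) ∧ ∀ x : P, χ.1 x = φ x}

theorem CharDeg.conj {n : ℕ} {H : Type*} [Group H] (χ : CharDeg n H) (g h : H) :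
    χ.1 (h * g * h⁻¹) = χ.1 g := by
  obtain ⟨_, ρ, rfl⟩ := χ
  exact ρ.char_conj g h

/-- Pulling back a character along a group homomorphism. -/
def CharDeg.pullback {n : ℕ} {H K : Type*} [Group H] [Group K] (f : H →* K) (χ : CharDeg n K) :
    CharDeg n H :=
  ⟨fun x => χ.1 (f x), by
    obtain ⟨_, ρ, rfl⟩ := χ
    exact ⟨ρ.comp f, rfl⟩⟩

theorem conj_mem_of_gmap {G : Type*} [Group G] {P Q : Subgroup G} (f : (G ⧸ P) →[G] (G ⧸ Q))
    {g : G} (hg : f ((1 : G) : G ⧸ P) = (g : G ⧸ Q)) (x : P) : g⁻¹ * x * g ∈ Q := by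
  have h : (x : G) • f ((1 : G) : G ⧸ P) = f ((1 : G) : G ⧸ P) := by
    rw [← map_smul]
    congr 1
    rw [MulAction.Quotient.smul_coe, QuotientGroup.eq]
    simp
  rw [hg, MulAction.Quotient.smul_coe] at h
  rw [mul_assoc]
  exact QuotientGroup.eq.mp h.symm

/-- The homomorphism `x ↦ g⁻¹ x g` from `P` to `Q`, when `f : G/P → G/Q` is a `G`-map with
`f(P) = gQ`. -/
def conjHom {G : Type*} [Group G] {P Q : Subgroup G} (f : (G ⧸ P) →[G] (G ⧸ Q))
    (g : G) (hg : f ((1 : G) : G ⧸ P) = (g : G ⧸ Q)) : P →* Q where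
  toFun x := ⟨g⁻¹ * x * g, conj_mem_of_gmap f hg x⟩
  map_one' := by ext; simp
  map_mul' x y := by ext; simp [mul_assoc]

/-- The map `Char_n(Q) → Char_n(P)` induced by a `G`-map `f : G/P → G/Q`: it sends `χ` to
`x ↦ χ(g⁻¹ x g)`, where `f(P) = gQ`. -/
noncomputable def CharDeg.restrict {G : Type*} [Group G] {n : ℕ} {P Q : Subgroup G}
    (f : (G ⧸ P) →[G] (G ⧸ Q)) (χ : CharDeg n Q) : CharDeg n P :=
  CharDeg.pullback (conjHom f (f ((1 : G) : G ⧸ P)).out (QuotientGroup.out_eq' _).symm) χ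

/-- The induced map on characters does not depend on the choice of `g`. -/
theorem CharDeg.restrict_apply {G : Type*} [Group G] {n : ℕ} {P Q : Subgroup G}
    (f : (G ⧸ P) →[G] (G ⧸ Q)) (χ : CharDeg n Q) (g : G)
    (hg : f ((1 : G) : G ⧸ P) = (g : G ⧸ Q)) (x : P) :
    (CharDeg.restrict f χ).1 x = χ.1 ⟨g⁻¹ * x * g, conj_mem_of_gmap f hg x⟩ := by
  have hout : ((f ((1 : G) : G ⧸ P)).out : G ⧸ Q) = (g : G ⧸ Q) :=
    (QuotientGroup.out_eq' _).trans hg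
  have hq := QuotientGroup.eq.mp hout
  rw [← CharDeg.conj χ ⟨g⁻¹ * x * g, conj_mem_of_gmap f hg x⟩ ⟨_, hq⟩]
  refine congrArg χ.1 (Subtype.ext ?_)
  simp [conjHom, mul_assoc]

theorem CharDeg.restrict_id {G : Type*} [Group G] {n : ℕ} {P : Subgroup G} (χ : CharDeg n P) :
    CharDeg.restrict (MulActionHom.id G) χ = χ := by
  ext x
  exact (CharDeg.restrict_apply _ χ 1 rfl x).trans (congrArg χ.1 (by simp))

theorem CharDeg.restrict_comp {G : Type*} [Group G] {n : ℕ} {P Q R : Subgroup G}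
    (f : (G ⧸ P) →[G] (G ⧸ Q)) (g : (G ⧸ Q) →[G] (G ⧸ R)) (χ : CharDeg n R) :
    CharDeg.restrict (g.comp f) χ = CharDeg.restrict f (CharDeg.restrict g χ) := by
  ext x
  obtain ⟨a, ha⟩ := QuotientGroup.mk_surjective (g ((1 : G) : G ⧸ Q))
  obtain ⟨b, hb⟩ := QuotientGroup.mk_surjective (f ((1 : G) : G ⧸ P))
  have hab : (g.comp f) ((1 : G) : G ⧸ P) = ((b * a : G) : G ⧸ R) := by
    have h1 : ((b : G) : G ⧸ Q) = b • ((1 : G) : G ⧸ Q) := by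
      rw [MulAction.Quotient.smul_coe, smul_eq_mul, mul_one]
    rw [MulActionHom.comp_apply, ← hb, h1, map_smul, ← ha, MulAction.Quotient.smul_coe,
      smul_eq_mul]
  rw [CharDeg.restrict_apply _ χ (b * a) hab x,
    CharDeg.restrict_apply _ (CharDeg.restrict g χ) b hb.symm x,
    CharDeg.restrict_apply _ χ a ha.symm]
  exact congrArg χ.1 (by simp [mul_assoc])

/-- The contravariant functor `G/P ↦ Char_n(P)` on the orbit category. -/
noncomputable def charFunctor.{u} {G : Type u} [Group G] (C : Set (Subgroup G)) (n : ℕ) :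
    (OrbitCat C)ᵒᵖ ⥤ Type u where
  obj X := CharDeg n X.unop.stab
  map f := ↾fun χ => CharDeg.restrict f.unop χ
  map_id X :=
    ConcreteCategory.hom_ext _ _ fun χ => CharDeg.restrict_id χ
  map_comp f g :=
    ConcreteCategory.hom_ext _ _ fun χ => CharDeg.restrict_comp g.unop f.unop χ

/-- The inverse limit of `Char_n(P)` over the orbit category of the collection `C`, that is, the
set of families `(χ_P)` with `χ_P ∈ Char_n(P)` that are compatible with all `G`-maps. -/
abbrev charLimit {G : Type*} [Group G] (C : Set (Subgroup G)) (n : ℕ) :=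
  (charFunctor C n).sections

/-- The projection of the inverse limit to the factor `Char_n(P)`, for `P ∈ C`. -/
def charProj {G : Type*} [Group G] {C : Set (Subgroup G)} (n : ℕ) {P : Subgroup G} (hP : P ∈ C) :
    charLimit C n → CharDeg n P :=
  fun γ => γ.1 (Opposite.op ⟨P, hP⟩)

/-!
The content is a form of Alperin's fusion theorem. A `p`-subgroup lies in a conjugate of `G_p`, so
a compatible family is determined by its value at `G_p`; and a character of `G_p` that extends to a
class function `φ` on `G` gives the compatible family `P ↦ φ|_P`. It remains to see that the member
at `G_p` of a compatible family `(χ_P)` does not distinguish `G`-conjugate elements. Since `χ` is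
compatible with conjugation between Sylow subgroups, this amounts to `χ_S = χ_T` on `S ∩ T` for any
two Sylow subgroups `S` and `T` (`conj_invariant_agree`).

Let `R ≤ S ∩ T`, and assume the claim for all `p`-subgroups that properly contain `R`. If `R` is
principal `p`-radical, both functions restrict to `χ_R`. If not, there is a subgroup `K`, normal in
`N_G(R)`, such that `K / R C_G(R)` is a `p`-group and `R` is not a Sylow subgroup of `K`
(`exists_normal_of_not_isPrincipalPRadical`): when `R` is `p`-centric it comes from a normal
`p`-subgroup of `N_G(R) / R C_G(R)`, and otherwise `K = R C_G(R)` will do. Choose Sylow subgroups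
`U ≥ N_S(R)` and `V ≥ N_T(R)` of `G` which meet `K` in Sylow subgroups of `K`. As
`K = (U ∩ K) C_G(R)`, some `c ∈ C_G(R)` conjugates `U ∩ K` to `V ∩ K`. In the chain
`S, U, c U c⁻¹, V, T` the first two and the last three terms are linked by intersections that
properly contain `R`, so the claim holds for these pairs, while `U` and `c U c⁻¹` give the same
function on `R` because `c` centralizes `R`.
-/

/-! ### Sylow subgroups of normal subgroups -/

theorem Sylow.mem_smul_iff {G : Type*} [Group G] {p : ℕ} {g x : G} {S : Sylow p G} :
    x ∈ g • S ↔ g⁻¹ * x * g ∈ S := by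
  change x ∈ ((g • S : Sylow p G) : Subgroup G) ↔ _
  rw [Sylow.coe_subgroup_smul, Subgroup.mem_pointwise_smul_iff_inv_smul_mem, ← map_inv,
    MulAut.smul_def, MulAut.conj_apply, inv_inv]
  rfl

/-- A Sylow subgroup of `G` meets a normal subgroup `K` in a Sylow subgroup of `K`. -/
theorem Sylow.not_dvd_relIndex_of_normal {G : Type*} [Group G] [Finite G] {p : ℕ}
    [Fact p.Prime] (Q : Sylow p G) (K : Subgroup G) [K.Normal] :
    ¬ p ∣ (Q : Subgroup G).relIndex K := by
  have h1 := Subgroup.relIndex_mul_relIndex ((Q : Subgroup G) ⊓ K) K (Q ⊔ K) inf_le_right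
    le_sup_right
  have h2 := Subgroup.relIndex_mul_relIndex ((Q : Subgroup G) ⊓ K) Q (Q ⊔ K) inf_le_left
    le_sup_left
  rw [← h2, Subgroup.relIndex_sup_right, Subgroup.inf_relIndex_right, Subgroup.inf_relIndex_left,
    mul_comm] at h1
  have hpos : 0 < K.relIndex Q := 
    Nat.pos_of_dvd_of_pos (K.relIndex_dvd_card Q) Nat.card_pos
  rw [Nat.eq_of_mul_eq_mul_left hpos h1]
  exact fun h => Q.not_dvd_index (h.trans (Subgroup.relIndex_dvd_index_of_le le_sup_left))

/-- A `p`-subgroup `M` normalizing `K` lies in a Sylow subgroup of `G` that meets `K` in a Sylow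
subgroup of `K`. -/
theorem exists_sylow_ge_not_dvd_relIndex {G : Type*} [Group G] [Finite G] {p : ℕ} [Fact p.Prime]
    {M N K : Subgroup G} (hM : IsPGroup p M) (hMN : M ≤ N) (hKN : K ≤ N)
    (hNK : N ≤ Subgroup.normalizer (K : Set G)) :
    ∃ U : Sylow p G, M ≤ U ∧ ¬ p ∣ (U : Subgroup G).relIndex K := by
  have hnorm : (K.subgroupOf N).Normal := (Subgroup.normal_subgroupOf_iff_le_normalizer hKN).2 hNK
  obtain ⟨Q, hQ⟩ := (hM.comap_of_injective N.subtype N.subtype_injective).exists_le_sylow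
  obtain ⟨U, hU⟩ := (Q.isPGroup'.map N.subtype).exists_le_sylow
  refine ⟨U, ?_, fun h => Q.not_dvd_relIndex_of_normal (K.subgroupOf N) ?_⟩
  · rw [← Subgroup.map_subgroupOf_eq_of_le hMN]
    exact (Subgroup.map_mono hQ).trans hU
  · rw [← Subgroup.relIndex_map_map_of_injective _ _ N.subtype_injective,
      Subgroup.map_subgroupOf_eq_of_le hKN]
    exact h.trans (Subgroup.relIndex_dvd_of_le_left K hU)

/-- Let `U` and `V` meet `K` in Sylow subgroups of `K`, both containing `R`. If `R C_G(R)` has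
`p`-power index in `K`, then an element of `C_G(R)` conjugates `U ∩ K` to `V ∩ K`. -/
theorem exists_centralizer_conj {G : Type*} [Group G] [Finite G] {p : ℕ} [Fact p.Prime]
    {R K : Subgroup G} (hRK : R ⊔ Subgroup.centralizer (R : Set G) ≤ K)
    (hKR : K ≤ Subgroup.normalizer (R : Set G)) {k : ℕ}
    (hk : (R ⊔ Subgroup.centralizer (R : Set G)).relIndex K = p ^ k) {U V : Sylow p G}
    (hRU : R ≤ U) (hU : ¬ p ∣ (U : Subgroup G).relIndex K)
    (hV : ¬ p ∣ (V : Subgroup G).relIndex K) :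
    ∃ c ∈ Subgroup.centralizer (R : Set G), ∀ x ∈ (V : Subgroup G) ⊓ K, c⁻¹ * x * c ∈ U := by
  set C := Subgroup.centralizer (R : Set G) with hC
  -- `[K : (U ∩ K) C]` divides both `[K : U ∩ K]`, which is prime to `p`, and a power of `p`.
  have hgen : K ≤ ((U : Subgroup G) ⊓ K) ⊔ C := by
    rw [← Subgroup.relIndex_eq_one]
    have h1 : (((U : Subgroup G) ⊓ K) ⊔ C).relIndex K ∣ p ^ k := by
      rw [← hk]
      exact Subgroup.relIndex_dvd_of_le_left K
        (sup_le_sup_right (le_inf hRU (le_sup_left.trans hRK)) C)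
    have h2 : (((U : Subgroup G) ⊓ K) ⊔ C).relIndex K ∣ (U : Subgroup G).relIndex K := by
      rw [← Subgroup.inf_relIndex_right (U : Subgroup G) K]
      exact Subgroup.relIndex_dvd_of_le_left K le_sup_left
    obtain ⟨j, -, hj⟩ := (Nat.dvd_prime_pow Fact.out).1 h1
    rcases Nat.eq_zero_or_pos j with rfl | hpos
    · simpa using hj
    · exact absurd ((hj ▸ dvd_pow_self p hpos.ne').trans h2) hU
  have hUp : IsPGroup p ((U : Subgroup G).subgroupOf K) :=
    U.isPGroup'.comap_of_injective K.subtype K.subtype_injective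
  have hVp : IsPGroup p ((V : Subgroup G).subgroupOf K) :=
    V.isPGroup'.comap_of_injective K.subtype K.subtype_injective
  obtain ⟨⟨y, hy⟩, hyUV⟩ := MulAction.exists_smul_eq K (hUp.toSylow hU) (hVp.toSylow hV)
  have hconj : ∀ x ∈ (V : Subgroup G) ⊓ K, y⁻¹ * x * y ∈ (U : Subgroup G) := by
    rintro x ⟨hxV, hxK⟩
    have hx : (⟨x, hxK⟩ : K) ∈ hVp.toSylow hV := hxV
    rw [← hyUV, Sylow.mem_smul_iff] at hx
    exact hx
  have hnorm : ((U : Subgroup G) ⊓ K) ≤ Subgroup.normalizer (C : Set G) :=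
    inf_le_right.trans (hKR.trans ((Subgroup.normal_subgroupOf_iff_le_normalizer
      (Subgroup.centralizer_le_normalizer _)).1 inferInstance))
  have hyC : y ∈ C ⊔ ((U : Subgroup G) ⊓ K) := sup_comm C ((U : Subgroup G) ⊓ K) ▸ hgen hy
  rw [← SetLike.mem_coe, Subgroup.coe_mul_of_right_le_normalizer_left _ _ hnorm] at hyC
  obtain ⟨c, hc, u, hu, rfl⟩ := hyC
  refine ⟨c, hc, fun x hx => ?_⟩
  have huU : u ∈ (U : Subgroup G) := hu.1
  have h := mul_mem (mul_mem huU (hconj x hx)) (inv_mem huU)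
  change c⁻¹ * x * c ∈ (U : Subgroup G)
  simpa [mul_assoc] using h

/-! ### Subgroups that are not principal `p`-radical -/

/-- Here `K / R C_G(R)` is trivial if `R` is not `p`-centric, and otherwise a non-trivial normal
`p`-subgroup of `N_G(R) / R C_G(R)`. -/
theorem exists_normal_of_not_isPrincipalPRadical {G : Type*} [Group G] [Finite G] {p : ℕ}
    [Fact p.Prime] {R : Subgroup G} (hR : IsPGroup p R) (hRC : ¬ IsPrincipalPRadical p R) :
    ∃ K : Subgroup G, R ⊔ Subgroup.centralizer (R : Set G) ≤ K ∧
      K ≤ Subgroup.normalizer (R : Set G) ∧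
      Subgroup.normalizer (R : Set G) ≤ Subgroup.normalizer (K : Set G) ∧
      (∃ k, (R ⊔ Subgroup.centralizer (R : Set G)).relIndex K = p ^ k) ∧ p ∣ R.relIndex K := by
  set N := Subgroup.normalizer (R : Set G) with hN
  set C := Subgroup.centralizer (R : Set G) with hC
  have hRCN : R ⊔ C ≤ N := sup_le Subgroup.le_normalizer (Subgroup.centralizer_le_normalizer _)
  have hmap : (centralProduct R).map N.subtype = R ⊔ C := Subgroup.map_subgroupOf_eq_of_le hRCN
  have hnormal : ∀ L : Subgroup N, L.Normal → N ≤ Subgroup.normalizer (L.map N.subtype : Set G) := by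
    intro L hL
    have := (Subgroup.normal_subgroupOf_iff_le_normalizer (H := L.map N.subtype) (K := N)
      (Subgroup.map_subtype_le L)).1
    apply this
    rwa [Subgroup.subgroupOf, Subgroup.comap_map_eq_self_of_injective N.subtype_injective]
  by_cases hcen : IsPCentric p R
  · have hrad : ¬ NoNormalPSubgroup p (N ⧸ centralProduct R) := fun h => hRC ⟨hcen, h⟩
    simp only [NoNormalPSubgroup, not_forall] at hrad
    obtain ⟨L, hL, hLp, hLbot⟩ := hrad
    have hle : centralProduct R ≤ L.comap (QuotientGroup.mk' (centralProduct R)) := by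
      exact (QuotientGroup.ker_mk' (centralProduct R)).ge.trans (Subgroup.ker_le_comap _ _)
    have hcard : (R ⊔ C).relIndex
        ((L.comap (QuotientGroup.mk' (centralProduct R))).map N.subtype) = Nat.card L := by
      rw [← hmap, Subgroup.relIndex_map_map_of_injective _ _ N.subtype_injective]
      have h := Subgroup.relIndex_ker (L.comap (QuotientGroup.mk' (centralProduct R)))
        (QuotientGroup.mk' (centralProduct R))
      rwa [QuotientGroup.ker_mk',
        Subgroup.map_comap_eq_self_of_surjective (QuotientGroup.mk'_surjective _)] at h
    obtain ⟨k, hk⟩ := IsPGroup.iff_card.mp hLp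
    have hle' := (Subgroup.map_mono (f := N.subtype) hle)
    rw [hmap] at hle'
    refine ⟨_, hle', Subgroup.map_subtype_le _, hnormal _ (hL.comap _),
      ⟨k, hcard.trans hk⟩, ?_⟩
    rw [← Subgroup.relIndex_mul_relIndex R _ _ le_sup_left hle', hcard, hk]
    refine Dvd.dvd.mul_left (dvd_pow_self p ?_) _
    rintro rfl
    exact hLbot (Subgroup.card_eq_one.mp (by simpa using hk))
  · -- `[R C_G(R) : R] = [C_G(R) : R ∩ C_G(R)]`, and `R ∩ C_G(R)` is the center of `R`.
    refine ⟨R ⊔ C, le_rfl, hRCN, ?_, ⟨0, by simp⟩, ?_⟩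
    · exact hmap ▸ hnormal _ inferInstance
    · by_contra hdvd
      refine hcen ⟨hR, ?_⟩
      have hp : IsPGroup p (R.subgroupOf C) :=
        hR.comap_of_injective C.subtype C.subtype_injective
      have hndvd : ¬ p ∣ (R.subgroupOf C).index := by
        have hnorm : (R.subgroupOf N).Normal :=
          (Subgroup.normal_subgroupOf_iff_le_normalizer Subgroup.le_normalizer).2 le_rfl
        have h := Subgroup.relIndex_sup_left (C.subgroupOf N) (R.subgroupOf N)
        rw [← Subgroup.subgroupOf_sup Subgroup.le_normalizer
          (Subgroup.centralizer_le_normalizer (R : Set G)), Subgroup.relIndex_subgroupOf hRCN,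
          Subgroup.relIndex_subgroupOf (Subgroup.centralizer_le_normalizer _)] at h
        change ¬ p ∣ R.relIndex C
        rwa [← h]
      refine ⟨hp.toSylow hndvd, ?_⟩
      ext x
      simp only [IsPGroup.toSylow_coe, Subgroup.subgroupOf_map_subtype, Subgroup.mem_inf,
        Subgroup.mem_map, Subgroup.mem_center_iff, Subgroup.subtype_apply, Subtype.exists,
        Subtype.forall, Subtype.ext_iff, Subgroup.coe_mul, C, Subgroup.mem_centralizer_iff,
        SetLike.mem_coe]
      constructor
      · rintro ⟨hx, hxC⟩
        exact ⟨x, hx, hxC, rfl⟩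
      · rintro ⟨x, hx, hxC, rfl⟩
        exact ⟨hx, hxC⟩

/-! ### Alperin's fusion argument -/

/-- The normalizer condition in a `p`-group, for subgroups of an ambient group. -/
theorem lt_normalizer_inf_of_lt {G : Type*} [Group G] [Finite G] {p : ℕ} [Fact p.Prime]
    {R S : Subgroup G} (hS : IsPGroup p S) (hRS : R < S) :
    R < Subgroup.normalizer (R : Set G) ⊓ S := by
  have := hS.isNilpotent
  have hlt := Group.normalizerCondition_of_isNilpotent (R.subgroupOf S)
    (lt_top_iff_ne_top.2 fun h => hRS.not_ge (Subgroup.subgroupOf_eq_top.1 h))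
  rw [← Subgroup.subgroupOf_normalizer_eq hRS.le] at hlt
  have := (Subgroup.map_lt_map_iff_of_injective S.subtype_injective).2 hlt
  rwa [Subgroup.map_subgroupOf_eq_of_le hRS.le, Subgroup.subgroupOf_map_subtype] at this

/-- Functions `F S` on the Sylow subgroups `S` of `G`, compatible with conjugation, agree on all
intersections as soon as they agree on the principal `p`-radical subgroups. Values of `F S` outside
`S` play no role. -/
theorem conj_invariant_agree {G α : Type*} [Group G] [Finite G] {p : ℕ} [Fact p.Prime]
    (F : Sylow p G → G → α)
    (hconj : ∀ (g : G) (S : Sylow p G), ∀ x ∈ S, F (g • S) (g * x * g⁻¹) = F S x)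
    (hrad : ∀ R ∈ principalPRadicals p G, ∀ S T : Sylow p G, R ≤ S → R ≤ T →
      ∀ x ∈ R, F S x = F T x)
    (R : Subgroup G) (S T : Sylow p G) (hRS : R ≤ S) (hRT : R ≤ T) {x : G} (hx : x ∈ R) :
    F S x = F T x := by
  induction R using WellFoundedGT.induction generalizing S T x with
  | ind R ih =>
    have hRp : IsPGroup p R := S.isPGroup'.to_le hRS
    by_cases hRC : IsPrincipalPRadical p R
    · exact hrad R hRC S T hRS hRT x hx
    obtain ⟨K, hRCK, hKN, hNK, ⟨k, hk⟩, hdvd⟩ := exists_normal_of_not_isPrincipalPRadical hRp hRC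
    have hRK : R ≤ K := le_sup_left.trans hRCK
    have hlink : ∀ S : Sylow p G, R ≤ S → ∃ U : Sylow p G, R ≤ U ∧
        ¬ p ∣ (U : Subgroup G).relIndex K ∧ F S x = F U x := by
      intro S hRS
      have hlt : R < (S : Subgroup G) := by
        refine lt_of_le_of_ne hRS ?_
        rintro rfl
        exact hRC (sylow_mem_principalPRadicals S)
      have hlt' := lt_normalizer_inf_of_lt S.isPGroup' hlt
      obtain ⟨U, hMU, hU⟩ := exists_sylow_ge_not_dvd_relIndex
        (S.isPGroup'.to_le inf_le_right) inf_le_left hKN hNK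
      exact ⟨U, hlt'.le.trans hMU, hU, ih _ hlt' S U inf_le_right hMU (hlt'.le hx)⟩
    obtain ⟨U, hRU, hU, hSU⟩ := hlink S hRS
    obtain ⟨V, hRV, hV, hTV⟩ := hlink T hRT
    obtain ⟨c, hc, hcUV⟩ := exists_centralizer_conj hRCK hKN hk hRU hU hV
    have hcU : F (c • U) x = F U x := by
      have h := hconj c U x (hRU hx)
      rwa [← Subgroup.mem_centralizer_iff.1 hc x hx, mul_inv_cancel_right] at h
    -- `V ∩ K` is a Sylow subgroup of `K`, and `R` is not.
    have hlt : R < (V : Subgroup G) ⊓ K := by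
      refine lt_of_le_of_ne (le_inf hRV hRK) fun h => hV ?_
      rwa [← Subgroup.inf_relIndex_right, ← h]
    have hle : (V : Subgroup G) ⊓ K ≤ (c • U : Sylow p G) := by
      intro y hy
      exact Sylow.mem_smul_iff.2 (hcUV y hy)
    rw [hSU, hTV, ← hcU]
    exact ih _ hlt (c • U) V hle inf_le_left (hlt.le hx)

/-! ### Compatible families of characters -/

/-- The `G`-map `G/P → G/Q` sending `P` to `gQ`, for `g⁻¹ P g ≤ Q`. -/
def gmapOfConj {G : Type*} [Group G] {P Q : Subgroup G} (g : G)
    (h : ∀ x ∈ P, g⁻¹ * x * g ∈ Q) : (G ⧸ P) →[G] (G ⧸ Q) where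
  toFun := Quotient.map' (fun a => a * g) fun a b hab => by
    rw [QuotientGroup.leftRel_apply] at hab ⊢
    simpa [mul_assoc] using h _ hab
  map_smul' a b := by
    induction b using QuotientGroup.induction_on with
    | H b => exact congrArg (QuotientGroup.mk (s := Q)) (mul_assoc a b g)

theorem gmapOfConj_one {G : Type*} [Group G] {P Q : Subgroup G} (g : G)
    (h : ∀ x ∈ P, g⁻¹ * x * g ∈ Q) : gmapOfConj g h ((1 : G) : G ⧸ P) = (g : G ⧸ Q) :=
  congrArg (QuotientGroup.mk (s := Q)) (one_mul g)

/-- Compatibility of a family with the `G`-map `gmapOfConj g h`, in terms of elements. -/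
theorem charLimit_apply_conj {G : Type*} [Group G] {C : Set (Subgroup G)} {n : ℕ}
    (γ : charLimit C n) {P Q : Subgroup G} (hP : P ∈ C) (hQ : Q ∈ C) (g : G)
    (h : ∀ x ∈ P, g⁻¹ * x * g ∈ Q) (x : P) :
    (charProj n hP γ).1 x = (charProj n hQ γ).1 ⟨g⁻¹ * x * g, h x x.2⟩ := by
  let f : (⟨P, hP⟩ : OrbitCat C) ⟶ ⟨Q, hQ⟩ := gmapOfConj g h
  have h1 : CharDeg.restrict (gmapOfConj g h) (charProj n hQ γ) = charProj n hP γ := γ.2 f.op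
  rw [← h1]
  exact CharDeg.restrict_apply _ _ g (gmapOfConj_one g h) x

theorem exists_conj_mem_sylow {G : Type*} [Group G] [Finite G] {p : ℕ} [Fact p.Prime]
    {P : Subgroup G} (hP : IsPGroup p P) (S : Sylow p G) : ∃ g : G, ∀ x ∈ P, g⁻¹ * x * g ∈ S := by
  obtain ⟨Q, hQ⟩ := hP.exists_le_sylow
  obtain ⟨g, rfl⟩ := MulAction.exists_smul_eq G S Q
  exact ⟨g, fun x hx => Sylow.mem_smul_iff.1 (hQ hx)⟩

open Classical in
/-- The member at a Sylow subgroup `S` of a compatible family takes the same value at any two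
elements of `S` that are conjugate in `G`. -/
theorem charProj_sylow_conj_eq {G : Type*} [Group G] [Finite G] {p : ℕ} [Fact p.Prime] {n : ℕ}
    (γ : charLimit (principalPRadicals p G) n) (S : Sylow p G) (g : G) (x y : S)
    (hxy : (y : G) = g * x * g⁻¹) :
    (charProj n (sylow_mem_principalPRadicals S) γ).1 x =
      (charProj n (sylow_mem_principalPRadicals S) γ).1 y := by
  let F : Sylow p G → G → ℂ := fun T z =>
    if hz : z ∈ T then (charProj n (sylow_mem_principalPRadicals T) γ).1 ⟨z, hz⟩ else 0
  have hmem : ∀ (g : G) (T : Sylow p G), ∀ z ∈ T, g * z * g⁻¹ ∈ g • T := by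
    intro g T z hz
    rw [Sylow.mem_smul_iff]
    simpa [mul_assoc] using hz
  have hconj : ∀ (g : G) (T : Sylow p G), ∀ z ∈ T, F (g • T) (g * z * g⁻¹) = F T z := by
    intro g T z hz
    have hz' := hmem g T z hz
    simp only [F, dif_pos hz, dif_pos hz']
    rw [charLimit_apply_conj γ (sylow_mem_principalPRadicals T)
      (sylow_mem_principalPRadicals (g • T)) g⁻¹
      (fun z hz => by rw [inv_inv]; exact hmem g T z hz)]
    simp
  have hrad : ∀ (R : Subgroup G) (hR : R ∈ principalPRadicals p G) (T : Sylow p G), R ≤ T →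
      ∀ z : R, F T z = (charProj n hR γ).1 z := by
    intro R hR T hT z
    have hz : (z : G) ∈ T := hT z.2
    simp only [F, dif_pos hz]
    rw [charLimit_apply_conj γ hR (sylow_mem_principalPRadicals T) 1
      (fun z hz => by simpa using hT hz)]
    simp
  have hy : (y : G) ∈ g • S := hxy ▸ hmem g S x x.2
  have h := conj_invariant_agree F hconj
    (fun R hR T T' hT hT' z hz => (hrad R hR T hT ⟨z, hz⟩).trans (hrad R hR T' hT' ⟨z, hz⟩).symm)
    ((S : Subgroup G) ⊓ (g • S : Sylow p G)) S (g • S) inf_le_left inf_le_right ⟨y.2, hy⟩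
  have h2 := hconj g S x x.2
  rw [← hxy, ← h] at h2
  simpa [F] using h2.symm

/-- Restricting a class function on `G` to all members of a collection gives a compatible family,
provided that the restrictions are characters. -/
theorem exists_charLimit_of_classFunction {G : Type*} [Group G] {C : Set (Subgroup G)} {n : ℕ}
    {φ : G → ℂ} (hφ : ∀ g x : G, φ (g * x * g⁻¹) = φ x)
    (h : ∀ P ∈ C, (fun x : P => φ x) ∈ CharDeg n P) :
    ∃ γ : charLimit C n, ∀ (P : Subgroup G) (hP : P ∈ C) (x : P), (charProj n hP γ).1 x = φ x := by
  refine ⟨⟨fun X => ⟨fun x => φ x, h X.unop.stab X.unop.mem⟩, ?_⟩, fun P hP x => rfl⟩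
  intro X Y f
  let f' : (G ⧸ Y.unop.stab) →[G] (G ⧸ X.unop.stab) := f.unop
  obtain ⟨g, hg⟩ := QuotientGroup.mk_surjective (f' ((1 : G) : G ⧸ Y.unop.stab))
  refine Subtype.ext (funext fun x => ?_)
  refine (CharDeg.restrict_apply f' _ g hg.symm x).trans ?_
  simpa using hφ g⁻¹ x

theorem theorem2 {G : Type*} [Group G] [Finite G] (p : ℕ) [Fact p.Prime] (hp : p ∣ Nat.card G)
    (Gp : Sylow p G) (n : ℕ) :
    Function.Injective (charProj n (sylow_mem_principalPRadicals Gp)) ∧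
      Set.range (charProj n (sylow_mem_principalPRadicals Gp)) =
        CharDegStable n (Gp : Subgroup G) := by
  refine ⟨fun γ δ h => ?_, Set.Subset.antisymm ?_ ?_⟩
  · refine Subtype.ext (funext fun X => ?_)
    obtain ⟨⟨P, hP⟩⟩ := X
    obtain ⟨g, hg⟩ := exists_conj_mem_sylow hP.1.1 Gp
    refine Subtype.ext (funext fun x => ?_)
    have h1 := charLimit_apply_conj γ hP (sylow_mem_principalPRadicals Gp) g hg x
    have h2 := charLimit_apply_conj δ hP (sylow_mem_principalPRadicals Gp) g hg x
    rw [h] at h1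
    exact h1.trans h2.symm
  · rintro _ ⟨γ, rfl⟩
    -- The class function takes the value of the character at any conjugate in `Gp`, and `0` on the
    -- classes that do not meet `Gp`.
    classical
    refine ⟨fun z => if hz : ∃ y : Gp, IsConj (y : G) z then
      (charProj n (sylow_mem_principalPRadicals Gp) γ).1 hz.choose else 0, fun g x => ?_,
      fun x => ?_⟩
    · have hiff : ∀ y : Gp, IsConj (y : G) (g * x * g⁻¹) ↔ IsConj (y : G) x := fun y =>
        have hx : IsConj x (g * x * g⁻¹) := isConj_iff.2 ⟨g, rfl⟩
        ⟨fun h => h.trans hx.symm, fun h => h.trans hx⟩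
      simp only [hiff]
    · have hz : ∃ y : Gp, IsConj (y : G) x := ⟨x, IsConj.refl _⟩
      simp only [dif_pos hz]
      obtain ⟨g, hg⟩ := isConj_iff.1 hz.choose_spec
      exact (charProj_sylow_conj_eq γ Gp g _ x hg.symm).symm
  · rintro χ ⟨φ, hφ, hχ⟩
    obtain ⟨γ, hγ⟩ := exists_charLimit_of_classFunction (C := principalPRadicals p G) (n := n) hφ
      (by
        intro P hP
        obtain ⟨g, hg⟩ := exists_conj_mem_sylow hP.1.1 Gp
        convert (CharDeg.restrict (gmapOfConj g hg) χ).2 using 1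
        funext x
        rw [CharDeg.restrict_apply _ χ g (gmapOfConj_one g hg) x, hχ]
        simpa using (hφ g⁻¹ x).symm)
    exact ⟨γ, Subtype.ext (funext fun x => (hγ _ _ x).trans (hχ x).symm)⟩
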